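/- Let $m$ be normalized Lebesgue measure on the unit circle $\mathbb{T}$, let $L^2=L^2(\mathbb{T},m)$ and $L^\infty=L^\infty(\mathbb{T},m)$, and let $H^2\subset L^2$ and $H^\infty\subset L^\infty$ be the Hardy spaces, i.e. the functions whose Fourier coefficients of negative index vanish. An inner function is a $\theta\in H^\infty$ with $|\theta|=1$ a.e. on $\mathbb{T}$ (constants are allowed), and for inner $\alpha,\theta$ write $\alpha\leqslant\theta$ if $\theta/\alpha$ is inner. For a function $f$ on $\mathbb{T}$ put $f^{\#}(z)=\overline{f(\bar z)}$. On $L^2$ let $M_zf=zf$, $J^{\star}f=f^{\#}$ and, for $\theta$ inner, $C_\theta f=\theta\,\bar z\,\bar f$. A conjugation in $L^2$ is an antilinear map $C:L^2\to L^2$ with $C^2=\mathrm{id}$ and $\langle Cg,Ch\rangle=\langle h,g\rangle$ for all $g,h\in L^2$. **Theorem 5.2.** Let $\theta$ and $\alpha$ be inner functions and let $C$ be a conjugation in $L^2$ such that $CM_z=M_zC$. Then $C(\alpha H^2)\subset\theta H^2$ if and only if $\theta\theta^{\#}\leqslant\alpha\alpha^{\#}$ and there exists an inner function $\beta$ such that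 $\theta\leqslant\beta$, $\beta\beta^{\#}=\alpha\alpha^{\#}$ and $C=C_\beta J^{\star}C_\alpha$. Moreover, for every such $\beta$ we have $C(\alpha H^2)=\beta H^2$. -/

import Mathlib

noncomputable section

namespace HardyConj

open MeasureTheory AddCircle
open scoped ENNReal ComplexConjugate

/-- Normalized Lebesgue (Haar probability) measure `m` on the unit circle `𝕋`. The circle is
parametrized by `t ∈ ℝ/ℤ` through `t ↦ z = exp (2πit)`, so that complex conjugation `z ↦ z̄`
becomes `t ↦ -t`. -/
abbrev circleMeasure : Measure UnitAddCircle := haarAddCircle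

/-- The Hilbert space `L² = L²(𝕋, m)`. -/
abbrev L2 : Type := Lp ℂ 2 circleMeasure

/-- The space `L^∞ = L^∞(𝕋, m)`. -/
abbrev Linf : Type := Lp ℂ ∞ circleMeasure

/-- The Hardy space `H²`, as a subspace of `L²`: the functions all of whose Fourier coefficients
of negative index vanish. -/
def H2 : Submodule ℂ L2 where
  carrier := {f | ∀ n : ℤ, n < 0 → fourierCoeff f n = 0}
  add_mem' := by
    intro f g hf hg n hn
    have h1 := hf n hn
    have h2 := hg n hn
    rw [← fourierBasis_repr] at h1 h2 ⊢
    rw [map_add, lp.coeFn_add, Pi.add_apply, h1, h2, add_zero]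
  zero_mem' := by
    intro n _
    rw [← fourierBasis_repr, map_zero, lp.coeFn_zero, Pi.zero_apply]
  smul_mem' := by
    intro c f hf n hn
    have h1 := hf n hn
    rw [← fourierBasis_repr] at h1 ⊢
    rw [map_smul, lp.coeFn_smul, Pi.smul_apply, h1, smul_zero]

/-- The Hardy space `H^∞`, as a subset of `L^∞`. -/
def Hinf : Set Linf := {φ | ∀ n : ℤ, n < 0 → fourierCoeff φ n = 0}

/-- `θ` is an inner function: `θ ∈ H^∞` and `|θ| = 1` a.e. on `𝕋` (constants are allowed). -/
def IsInner (θ : Linf) : Prop := θ ∈ Hinf ∧ ∀ᵐ t ∂circleMeasure, ‖θ t‖ = 1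

/-- The pointwise product in `L^∞`. -/
def prod (φ ψ : Linf) : Linf := φ • ψ

/-- The operator `M_φ` of multiplication by `φ ∈ L^∞` on `L²`. -/
def M (φ : Linf) (f : L2) : L2 := φ • f

/-- The coordinate function `z` on `𝕋`, as an element of `L^∞`. -/
def z : Linf := fourierLp ∞ 1

/-- `f^#(z) = conj (f (z̄))`, for `f` in any `L^p` of the circle. -/
def sharp {p : ℝ≥0∞} (f : Lp ℂ p circleMeasure) : Lp ℂ p circleMeasure :=
  star (Lp.compMeasurePreserving (fun t : UnitAddCircle => -t)
    (Measure.measurePreserving_neg circleMeasure) f)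

/-- `J^⋆ f = f^#` on `L²`. -/
def Jstar (f : L2) : L2 := sharp f

/-- `C_θ f = θ z̄ f̄` on `L²`. -/
def Cinner (θ : Linf) (f : L2) : L2 := M θ (M (star z) (star f))

/-- The order on inner functions: `α ≤ θ` means that `θ/α` is an inner function. -/
def InnerLE (α θ : Linf) : Prop :=
  ∃ u : Linf, IsInner u ∧ ∀ᵐ t ∂circleMeasure, u t = θ t / α t

/-- The subspace `θH² = {θ h : h ∈ H²}`, as a set. -/
def shiftInv (θ : Linf) : Set L2 := M θ '' (H2 : Set L2)

/-- A conjugation in a complex Hilbert space: an antilinear map `C` with `C² = id` and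
`⟨C g, C h⟩ = ⟨h, g⟩`. -/
structure IsConjugation {H : Type*} [NormedAddCommGroup H] [InnerProductSpace ℂ H]
    (C : H → H) : Prop where
  map_add : ∀ g h : H, C (g + h) = C g + C h
  map_smul : ∀ (c : ℂ) (h : H), C (c • h) = conj c • C h
  invol : ∀ h : H, C (C h) = h
  inner_map : ∀ g h : H, inner ℂ (C g) (C h) = inner ℂ h g

end HardyConj

end

/-!
The reflection `J^⋆ f = f^#` is an antilinear isometry commuting with `M_z`, so a conjugation `C`
commuting with `M_z` is determined by `ψ = C 1`, through `C f = ψ f^#`, first for monomials and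
then, by density, on all of `L²` (`exists_eq_M_Jstar`). Here `ψ` is unimodular: the relation
`⟨C 1, C zⁿ⟩ = ⟨zⁿ, 1⟩` gives `|ψ|²` the Fourier coefficients of the constant `1`
(`ae_norm_eq_one`). Moreover `C² = id` says `ψ ψ^# = 1`.

Since `(H²)^# = H²`, the image of `αH²` under `C` is `βH²` with `β = ψ α^#`. If it lies in `θH²`,
then `β = C(α · 1) = θ u` with `u ∈ H²` unimodular, that is, `u` inner. So `β` is inner, `θ ≤ β`,
`β β^# = α α^#`, and `C f = β conj(α^#) f^#`, which is the formula for `C_β J^⋆ C_α`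
(`coeFn_Cinner_Jstar_Cinner`, `exists_inner_of_image_subset`). The divisibility
`θ θ^# ≤ α α^# = β β^#` holds with quotient `u u^#` (`innerLE_prod_sharp`). Conversely,
`C_β J^⋆ C_α` maps `αH²` onto `βH²` (`image_shiftInv_eq`), which lies in `θH²` when `θ ≤ β`,
because `H^∞ · H² ⊆ H²` (`M_mem_H2`).
-/

noncomputable section

namespace HardyConj

open MeasureTheory AddCircle
open scoped ENNReal ComplexConjugate

/-! ### Pointwise descriptions of the operators -/

lemma coeFn_M (φ : Linf) (f : L2) : ⇑(M φ f) =ᵐ[circleMeasure] fun t => φ t * f t :=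
  Lp.coeFn_lpSMul φ f

lemma coeFn_prod (φ ψ : Linf) : ⇑(prod φ ψ) =ᵐ[circleMeasure] fun t => φ t * ψ t :=
  Lp.coeFn_lpSMul φ ψ

lemma coeFn_conj {p : ℝ≥0∞} (f : Lp ℂ p circleMeasure) :
    ⇑(star f) =ᵐ[circleMeasure] fun t => conj (f t) :=
  Lp.coeFn_star f

lemma coeFn_z : ⇑z =ᵐ[circleMeasure] fun t => fourier 1 t :=
  coeFn_fourierLp ∞ 1

lemma ae_neg {P : UnitAddCircle → Prop} (h : ∀ᵐ t ∂circleMeasure, P t) :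
    ∀ᵐ t ∂circleMeasure, P (-t) :=
  (Measure.measurePreserving_neg circleMeasure).quasiMeasurePreserving.ae h

lemma coeFn_sharp {p : ℝ≥0∞} (f : Lp ℂ p circleMeasure) :
    ⇑(sharp f) =ᵐ[circleMeasure] fun t => conj (f (-t)) := by
  filter_upwards [coeFn_conj (Lp.compMeasurePreserving (fun t : UnitAddCircle => -t)
    (Measure.measurePreserving_neg circleMeasure) f),
    Lp.coeFn_compMeasurePreserving f (Measure.measurePreserving_neg circleMeasure)] with t h1 h2
  rw [sharp, h1, h2, Function.comp_apply]

lemma conj_mul_self_of_norm_one {w : ℂ} (h : ‖w‖ = 1) : conj w * w = 1 := by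
  rw [Complex.conj_mul', h]; norm_num

lemma fourier_neg_arg (n : ℤ) (t : UnitAddCircle) :
    (fourier n (-t) : ℂ) = conj (fourier n t) := by
  rw [← fourier_neg, fourier_apply, fourier_apply, neg_smul, smul_neg]

lemma fourier_mul_neg (n : ℤ) (t : UnitAddCircle) :
    (fourier n t : ℂ) * fourier n (-t) = 1 := by
  rw [fourier_neg_arg, ← fourier_neg, ← fourier_add, add_neg_cancel, fourier_zero]

lemma coeFn_Cinner (α : Linf) (f : L2) :
    ⇑(Cinner α f) =ᵐ[circleMeasure] fun t => α t * (conj (fourier 1 t) * conj (f t)) := by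
  filter_upwards [coeFn_M α (M (star z) (star f)), coeFn_M (star z) (star f), coeFn_conj z,
    coeFn_conj f, coeFn_z] with t h1 h2 h3 h4 h5
  rw [Cinner, h1, h2, h3, h4, h5]

/-- In terms of functions, `C_β J^⋆ C_α f = β · conj(α^#) · f^#`. -/
lemma coeFn_Cinner_Jstar_Cinner (α β : Linf) (f : L2) :
    ⇑((Cinner β ∘ Jstar ∘ Cinner α) f) =ᵐ[circleMeasure]
      fun t => β t * α (-t) * conj (f (-t)) := by
  filter_upwards [coeFn_Cinner β (Jstar (Cinner α f)), coeFn_sharp (Cinner α f),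
    ae_neg (coeFn_Cinner α f)] with t h1 h2 h3
  simp only [Function.comp_apply]
  rw [h1, Jstar, h2, h3]
  simp only [map_mul, Complex.conj_conj]
  rw [fourier_neg_arg, Complex.conj_conj]
  have h : conj (fourier 1 t : ℂ) * fourier 1 t = 1 := by
    rw [← fourier_neg_arg, mul_comm, fourier_mul_neg]
  linear_combination β t * α (-t) * conj (f (-t)) * h

/-! ### Multiplication and reflection on the Hardy spaces -/

lemma fourierCoeff_sharp {p : ℝ≥0∞} (f : Lp ℂ p circleMeasure) (n : ℤ) :
    fourierCoeff (sharp f) n = conj (fourierCoeff f n) := by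
  rw [fourierCoeff_congr_ae (coeFn_sharp f), fourierCoeff, fourierCoeff, ← integral_conj,
    ← integral_neg_eq_self _ haarAddCircle]
  refine integral_congr_ae (.of_forall fun t => ?_)
  simp

lemma sharp_mem_H2 {f : L2} (hf : f ∈ H2) : sharp f ∈ H2 := fun n hn => by
  rw [fourierCoeff_sharp, hf n hn, map_zero]

lemma sharp_sharp {p : ℝ≥0∞} (f : Lp ℂ p circleMeasure) : sharp (sharp f) = f := by
  apply Lp.ext
  filter_upwards [coeFn_sharp (sharp f), ae_neg (coeFn_sharp f)] with t h1 h2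
  rw [h1, h2, Complex.conj_conj, neg_neg]

/-- `H^∞ · H² ⊆ H²`. The `n`-th coefficient of `φ g` is the inner product of `conj φ · zⁿ`, whose
spectrum lies in `(-∞, n]`, with `g`, whose spectrum lies in `[0, ∞)`. -/
lemma M_mem_H2 {φ : Linf} (hφ : φ ∈ Hinf) {g : L2} (hg : g ∈ H2) : M φ g ∈ H2 := by
  intro n hn
  set k : L2 := M (star φ) (fourierLp 2 n) with hk
  have hk' : ⇑k =ᵐ[circleMeasure] fun t => conj (φ t) * fourier n t := by
    filter_upwards [coeFn_M (star φ) (fourierLp 2 n), coeFn_conj φ,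
      coeFn_fourierLp (T := 1) 2 n] with t h1 h2 h3
    rw [hk, h1, h2, h3]
  have key : fourierCoeff (M φ g) n = inner ℂ k g := by
    rw [L2.inner_def, fourierCoeff]
    refine integral_congr_ae ?_
    filter_upwards [hk', coeFn_M φ g] with t h1 h2
    rw [h1, h2]
    simp
    ring
  have hs := (fourierBasis (T := 1)).hasSum_inner_mul_inner k g
  have hz : ∀ i : ℤ, inner ℂ k (fourierBasis (T := 1) i) *
      inner ℂ (fourierBasis (T := 1) i) g = 0 := by
    intro i
    rcases lt_or_ge i 0 with hi | hi
    · rw [← HilbertBasis.repr_apply_apply, fourierBasis_repr, hg i hi, mul_zero]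
    · have : inner ℂ k (fourierBasis (T := 1) i) = fourierCoeff φ (n - i) := by
        rw [L2.inner_def, fourierCoeff, coe_fourierBasis]
        refine integral_congr_ae ?_
        filter_upwards [hk', coeFn_fourierLp (T := 1) 2 i] with t h1 h2
        rw [h1, h2, neg_sub, sub_eq_add_neg, fourier_add, fourier_neg]
        simp
        ring
      rw [this, hφ _ (by omega), zero_mul]
  simp only [hz] at hs
  rw [key, hs.unique hasSum_zero]

/-- The constant function `1` in `L²`. -/
def one : L2 := fourierLp 2 0

lemma coeFn_one : ⇑one =ᵐ[circleMeasure] fun _ => 1 := by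
  filter_upwards [coeFn_fourierLp (T := 1) 2 0] with t h
  rw [one, h, fourier_zero]

lemma one_mem_H2 : one ∈ H2 := by
  intro n hn
  rw [← fourierBasis_repr, HilbertBasis.repr_apply_apply, coe_fourierBasis]
  exact orthonormal_fourier.2 hn.ne

lemma mem_Hinf_of_ae_eq {φ : Linf} {f : L2} (hf : f ∈ H2) (h : ⇑φ =ᵐ[circleMeasure] f) :
    φ ∈ Hinf := fun n hn => by
  rw [fourierCoeff_congr_ae h, hf n hn]

lemma IsInner.prod {φ ψ : Linf} (hφ : IsInner φ) (hψ : IsInner ψ) : IsInner (prod φ ψ) := by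
  constructor
  · refine mem_Hinf_of_ae_eq (M_mem_H2 hφ.1 (M_mem_H2 hψ.1 one_mem_H2)) ?_
    filter_upwards [coeFn_prod φ ψ, coeFn_M φ (M ψ one), coeFn_M ψ one, coeFn_one]
      with t h1 h2 h3 h4
    rw [h1, h2, h3, h4, mul_one]
  · filter_upwards [coeFn_prod φ ψ, hφ.2, hψ.2] with t h1 h2 h3
    rw [h1, norm_mul, h2, h3, one_mul]

lemma IsInner.sharp {φ : Linf} (hφ : IsInner φ) : IsInner (sharp φ) := by
  constructor
  · intro n hn
    rw [fourierCoeff_sharp, hφ.1 n hn, map_zero]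
  · filter_upwards [coeFn_sharp φ, ae_neg hφ.2] with t h1 h2
    rw [h1, RCLike.norm_conj, h2]

/-! ### Conjugations commuting with `M_z` -/

/-- A function in `L²` is unimodular as soon as `|f|²` has the Fourier coefficients of the constant
`1`: the trigonometric polynomials determine finite measures on the circle. -/
lemma ae_norm_eq_one {f : L2}
    (h : ∀ n : ℤ, ∫ t, fourier n t * (conj (f t) * f t) ∂circleMeasure =
      ∫ t, (fourier n t : ℂ) ∂circleMeasure) :
    ∀ᵐ t ∂circleMeasure, ‖f t‖ = 1 := by
  have hmeas : AEMeasurable (fun t => ‖f t‖₊ ^ 2) circleMeasure :=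
    (Lp.aestronglyMeasurable f).aemeasurable.nnnorm.pow_const 2
  have hfin : ∫⁻ t, ((‖f t‖₊ ^ 2 : NNReal) : ℝ≥0∞) ∂circleMeasure ≠ ∞ := by
    have := (Lp.memLp f).eLpNorm_lt_top
    rw [eLpNorm_lt_top_iff_lintegral_rpow_enorm_lt_top (by norm_num) (by norm_num)] at this
    simpa [enorm] using this.ne
  set ν : Measure UnitAddCircle :=
    circleMeasure.withDensity (fun t => ((‖f t‖₊ ^ 2 : NNReal) : ℝ≥0∞)) with hν
  have : IsFiniteMeasure ν := isFiniteMeasure_withDensity hfin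
  have hmono : ∀ n : ℤ, ∫ t, (fourier n t : ℂ) ∂ν = ∫ t, (fourier n t : ℂ) ∂circleMeasure := by
    intro n
    rw [hν, integral_withDensity_eq_integral_smul₀ hmeas, ← h n]
    refine integral_congr_ae (.of_forall fun t => ?_)
    simp only [Complex.conj_mul', NNReal.smul_def, Complex.real_smul]
    push_cast
    rw [mul_comm]
  have hint : ∀ (ρ : Measure UnitAddCircle) [IsFiniteMeasure ρ] (g : C(UnitAddCircle, ℂ)),
      Integrable g ρ := fun ρ _ g =>
    (BoundedContinuousFunction.mkOfCompact g).integrable ρ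
  -- Trigonometric polynomials form a point-separating star subalgebra, on which both measures have
  -- the same integrals.
  have hνμ : ν = circleMeasure := by
    refine ext_of_forall_mem_subalgebra_integral_eq_of_pseudoEMetric_complete_countable (𝕜 := ℂ)
      (A := fourierSubalgebra.comap (BoundedContinuousFunction.toContinuousMapStarₐ ℂ)) ?_ ?_
    · intro x y hxy
      obtain ⟨_, ⟨g, hg, rfl⟩, hne⟩ := fourierSubalgebra_separatesPoints (T := 1) hxy
      exact ⟨g, ⟨g, ⟨BoundedContinuousFunction.mkOfCompact g, hg, rfl⟩, rfl⟩, hne⟩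
    · intro g hg
      have hg' : (BoundedContinuousFunction.toContinuousMapStarₐ ℂ g) ∈
          Submodule.span ℂ (Set.range (fourier (T := 1))) := by
        rw [← fourierSubalgebra_coe]; exact hg
      have hG : ∀ G ∈ Submodule.span ℂ (Set.range (fourier (T := 1))),
          ∫ x, G x ∂ν = ∫ x, G x ∂circleMeasure := by
        intro G hG
        induction hG using Submodule.span_induction with
        | mem x hx => obtain ⟨n, rfl⟩ := hx; exact hmono n
        | zero => simp
        | add x y _ _ hx hy =>
          simp only [ContinuousMap.add_apply]
          rw [integral_add (hint _ x) (hint _ y), integral_add (hint _ x) (hint _ y), hx, hy]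
        | smul c x _ hx =>
          simp only [ContinuousMap.smul_apply]
          rw [integral_smul, integral_smul, hx]
      exact hG _ hg'
  have h1 : circleMeasure.withDensity (fun t => ((‖f t‖₊ ^ 2 : NNReal) : ℝ≥0∞)) =
      circleMeasure.withDensity (fun _ => 1) := by
    rw [← hν, hνμ]; exact withDensity_one.symm
  rw [withDensity_eq_iff hmeas.coe_nnreal_ennreal aemeasurable_const hfin] at h1
  filter_upwards [h1] with t ht
  have h2 : ‖f t‖₊ ^ 2 = 1 := by exact_mod_cast ht
  have h3 : ‖f t‖₊ = 1 := (pow_eq_one_iff_of_nonneg zero_le two_ne_zero).1 h2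
  exact congrArg NNReal.toReal h3

lemma IsConjugation.norm_map {C : L2 → L2} (hC : IsConjugation C) (f : L2) : ‖C f‖ = ‖f‖ := by
  rw [@norm_eq_sqrt_re_inner ℂ, @norm_eq_sqrt_re_inner ℂ, hC.inner_map]

lemma IsConjugation.continuous {C : L2 → L2} (hC : IsConjugation C) : Continuous C := by
  let A : L2 →+ L2 := AddMonoidHom.mk' C hC.map_add
  exact (AddMonoidHomClass.isometry_of_norm A hC.norm_map).continuous

/-- `C zⁿ = zⁿ · C 1` for all `n ∈ ℤ`: for negative `n` the factor `z` is cancelled. -/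
lemma map_fourierLp {C : L2 → L2} (hCz : C ∘ M z = M z ∘ C) (n : ℤ) :
    ⇑(C (fourierLp 2 n)) =ᵐ[circleMeasure] fun t => fourier n t * C one t := by
  have hsucc : ∀ m : ℤ, ⇑(C (fourierLp 2 (m + 1))) =ᵐ[circleMeasure]
      fun t => fourier 1 t * C (fourierLp 2 m) t := by
    intro m
    have h : (fourierLp 2 (m + 1) : L2) = M z (fourierLp 2 m) := by
      apply Lp.ext
      filter_upwards [coeFn_fourierLp (T := 1) 2 m, coeFn_fourierLp (T := 1) 2 (m + 1),
        coeFn_M z (fourierLp 2 m), coeFn_z] with t h1 h2 h3 h4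
      rw [h2, h3, h4, h1, add_comm, fourier_add]
    rw [h, show C (M z (fourierLp 2 m)) = M z (C (fourierLp 2 m)) from congrFun hCz _]
    filter_upwards [coeFn_M z (C (fourierLp 2 m)), coeFn_z] with t h1 h2
    rw [h1, h2]
  induction n using Int.induction_on with
  | zero => exact .of_forall fun t => by simp [one]
  | succ m ih =>
    filter_upwards [hsucc m, ih] with t h1 h2
    rw [h1, h2, add_comm, fourier_add, mul_assoc]
  | pred m ih =>
    have hs := hsucc (-m - 1)
    rw [sub_add_cancel] at hs
    filter_upwards [hs, ih] with t h1 h2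
    rw [h1] at h2
    have h3 : (fourier (-m : ℤ) t : ℂ) = fourier 1 t * fourier (-m - 1 : ℤ) t := by
      rw [← fourier_add]; congr 2; ring
    rw [h3, mul_assoc] at h2
    exact mul_left_cancel₀ (left_ne_zero_of_mul_eq_one (fourier_mul_neg 1 t)) h2

/-- `⟨C 1, C zⁿ⟩ = ⟨zⁿ, 1⟩` says that `|C 1|²` has the Fourier coefficients of `1`. -/
lemma ae_norm_map_one {C : L2 → L2} (hC : IsConjugation C) (hCz : C ∘ M z = M z ∘ C) :
    ∀ᵐ t ∂circleMeasure, ‖C one t‖ = 1 := by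
  refine ae_norm_eq_one fun n => ?_
  have h := hC.inner_map one (fourierLp 2 n)
  rw [L2.inner_def, L2.inner_def] at h
  have hl : ∫ t, inner ℂ (C one t) (C (fourierLp 2 n) t) ∂circleMeasure =
      ∫ t, fourier n t * (conj (C one t) * C one t) ∂circleMeasure := by
    refine integral_congr_ae ?_
    filter_upwards [map_fourierLp hCz n] with t h1
    rw [h1]; simp; ring
  have hr : ∫ t, inner ℂ ((fourierLp 2 n : L2) t) (one t) ∂circleMeasure =
      ∫ t, (fourier n t : ℂ) ∂circleMeasure := by
    rw [← integral_neg_eq_self _ haarAddCircle]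
    refine integral_congr_ae ?_
    filter_upwards [ae_neg (coeFn_fourierLp (T := 1) 2 n), ae_neg coeFn_one] with t h1 h2
    rw [h1, h2]; simp
  rw [← hl, h, hr]

lemma Jstar_add (f g : L2) : Jstar (f + g) = Jstar f + Jstar g := by
  apply Lp.ext
  filter_upwards [coeFn_sharp (f + g), coeFn_sharp f, coeFn_sharp g, ae_neg (Lp.coeFn_add f g),
    Lp.coeFn_add (Jstar f) (Jstar g)] with t h1 h2 h3 h4 h5
  rw [h5, Jstar, h1, h4]
  simp [Jstar, h2, h3]

lemma Jstar_smul (c : ℂ) (f : L2) : Jstar (c • f) = conj c • Jstar f := by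
  apply Lp.ext
  filter_upwards [coeFn_sharp (c • f), coeFn_sharp f, ae_neg (Lp.coeFn_smul c f),
    Lp.coeFn_smul (conj c) (Jstar f)] with t h1 h2 h3 h4
  rw [h4, Jstar, h1, h3]
  simp [Jstar, h2]

lemma norm_Jstar_le (f : L2) : ‖Jstar f‖ ≤ ‖f‖ := by
  have hmp := Measure.measurePreserving_neg circleMeasure
  rw [← Lp.norm_compMeasurePreserving f hmp]
  refine Lp.norm_le_norm_of_ae_le ?_
  filter_upwards [coeFn_sharp f, Lp.coeFn_compMeasurePreserving f hmp] with t h1 h2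
  rw [Jstar, h1, h2, RCLike.norm_conj, Function.comp_apply]

lemma continuous_Jstar : Continuous Jstar := by
  let A : L2 →+ L2 := AddMonoidHom.mk' Jstar Jstar_add
  exact AddMonoidHomClass.continuous_of_bound A 1 fun f =>
    (norm_Jstar_le f).trans_eq (one_mul _).symm

lemma M_add (φ : Linf) (f g : L2) : M φ (f + g) = M φ f + M φ g :=
  Lp.add_smul φ f g

lemma M_smul (φ : Linf) (c : ℂ) (f : L2) : M φ (c • f) = c • M φ f :=
  (Lp.smul_comm c φ f).symm

lemma continuous_M (φ : Linf) : Continuous (M φ) := by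
  let A : L2 →+ L2 := AddMonoidHom.mk' (M φ) (M_add φ)
  exact AddMonoidHomClass.continuous_of_bound A ‖φ‖ fun f => Lp.norm_smul_le φ f

/-- A conjugation commuting with `M_z` has the form `f ↦ ψ f^#` for a unimodular `ψ`, namely
`ψ = C 1`. -/
lemma exists_eq_M_Jstar {C : L2 → L2} (hC : IsConjugation C) (hCz : C ∘ M z = M z ∘ C) :
    ∃ ψ : Linf, (∀ᵐ t ∂circleMeasure, ‖ψ t‖ = 1) ∧ ∀ f, C f = M ψ (Jstar f) := by
  have hmem : MemLp (C one) ∞ circleMeasure :=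
    memLp_top_of_bound (Lp.aestronglyMeasurable _) 1
      ((ae_norm_map_one hC hCz).mono fun t ht => ht.le)
  have hψ : ⇑(hmem.toLp (C one)) =ᵐ[circleMeasure] C one := hmem.coeFn_toLp
  refine ⟨hmem.toLp (C one), ?_, fun f => ?_⟩
  · filter_upwards [hψ, ae_norm_map_one hC hCz] with t h1 h2
    rw [h1, h2]
  set ψ : Linf := hmem.toLp (C one)
  have hclosed : IsClosed {f : L2 | C f = M ψ (Jstar f)} :=
    isClosed_eq hC.continuous ((continuous_M ψ).comp continuous_Jstar)
  have hspan : (Submodule.span ℂ (Set.range (fourierLp (T := 1) 2)) : Set L2) ⊆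
      {f : L2 | C f = M ψ (Jstar f)} := by
    intro g hg
    induction hg using Submodule.span_induction with
    | mem x hx =>
      obtain ⟨n, rfl⟩ := hx
      apply Lp.ext
      filter_upwards [map_fourierLp hCz n, coeFn_M ψ (Jstar (fourierLp 2 n)),
        coeFn_sharp (fourierLp (T := 1) 2 n), ae_neg (coeFn_fourierLp (T := 1) 2 n), hψ]
        with t h1 h2 h3 h4 h5
      rw [h1, h2, h5, Jstar, h3, h4, fourier_neg_arg, Complex.conj_conj, mul_comm]
    | zero =>
      have h1 : C 0 = 0 := by simpa using hC.map_smul 0 0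
      have h2 : Jstar 0 = 0 := by simpa using Jstar_smul 0 0
      change C 0 = M ψ (Jstar 0)
      have h3 : M ψ 0 = 0 := by simpa using M_smul ψ 0 0
      rw [h1, h2, h3]
    | add x y _ _ hx hy =>
      change C (x + y) = M ψ (Jstar (x + y))
      rw [hC.map_add, hx, hy, Jstar_add, M_add]
    | smul c x _ hx =>
      change C (c • x) = M ψ (Jstar (c • x))
      rw [hC.map_smul, hx, Jstar_smul, M_smul]
  have htop := span_fourierLp_closure_eq_top (T := 1) (p := 2) (by norm_num)
  have hf : f ∈ (Submodule.span ℂ (Set.range (fourierLp (T := 1) 2))).topologicalClosure := by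
    rw [htop]; trivial
  exact closure_minimal hspan hclosed hf

/-! ### The images of the shift-invariant subspaces -/

/-- Since `C_β J^⋆ C_α (α h) = β h^#` and `H²` is invariant under the involution `h ↦ h^#`, the
image of `αH²` is all of `βH²`. -/
lemma image_shiftInv_eq {α β : Linf} (hα : IsInner α) :
    (Cinner β ∘ Jstar ∘ Cinner α) '' shiftInv α = shiftInv β := by
  have key : ∀ h : L2, (Cinner β ∘ Jstar ∘ Cinner α) (M α h) = M β (sharp h) := by
    intro h
    apply Lp.ext
    filter_upwards [coeFn_Cinner_Jstar_Cinner α β (M α h), ae_neg (coeFn_M α h), ae_neg hα.2,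
      coeFn_M β (sharp h), coeFn_sharp h] with t h1 h2 h3 h4 h5
    rw [h1, h2, h4, h5, map_mul]
    linear_combination β t * conj (h (-t)) * conj_mul_self_of_norm_one h3
  ext g
  constructor
  · rintro ⟨_, ⟨h, hh, rfl⟩, rfl⟩
    exact ⟨sharp h, sharp_mem_H2 hh, (key h).symm⟩
  · rintro ⟨h, hh, rfl⟩
    exact ⟨M α (sharp h), ⟨_, sharp_mem_H2 hh, rfl⟩, by rw [key, sharp_sharp]⟩

lemma shiftInv_subset_of_innerLE {θ β : Linf} (hθ : IsInner θ) (h : InnerLE θ β) :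
    shiftInv β ⊆ shiftInv θ := by
  obtain ⟨u, hu, hub⟩ := h
  rintro _ ⟨g, hg, rfl⟩
  refine ⟨M u g, M_mem_H2 hu.1 hg, ?_⟩
  apply Lp.ext
  filter_upwards [coeFn_M θ (M u g), coeFn_M u g, coeFn_M β g, hub, hθ.2] with t h1 h2 h3 h4 h5
  have h0 : θ t ≠ 0 := norm_ne_zero_iff.1 (by rw [h5]; exact one_ne_zero)
  rw [h1, h2, h3, h4]
  field_simp

/-- If `u = β / θ` is inner, then so is `u u^# = (β β^#) / (θ θ^#)`. -/
lemma innerLE_prod_sharp {θ β : Linf} (h : InnerLE θ β) :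
    InnerLE (prod θ (sharp θ)) (prod β (sharp β)) := by
  obtain ⟨u, hu, hub⟩ := h
  refine ⟨prod u (sharp u), hu.prod hu.sharp, ?_⟩
  filter_upwards [coeFn_prod u (sharp u), coeFn_sharp u, coeFn_prod θ (sharp θ), coeFn_sharp θ,
    coeFn_prod β (sharp β), coeFn_sharp β, hub, ae_neg hub] with t h1 h2 h3 h4 h5 h6 h7 h8
  rw [h1, h2, h3, h4, h5, h6, h7, h8, map_div₀]
  ring

/-- If `C(αH²) ⊆ θH²`, then `β = (C 1) α^# = C α` is the required inner function, with
`β / θ = conj θ · β`. -/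
lemma exists_inner_of_image_subset {α θ : Linf} (hα : IsInner α) (hθ : IsInner θ)
    {C : L2 → L2} (hC : IsConjugation C) (hCz : C ∘ M z = M z ∘ C)
    (hsub : C '' shiftInv α ⊆ shiftInv θ) :
    ∃ β : Linf, IsInner β ∧ InnerLE θ β ∧ prod β (sharp β) = prod α (sharp α) ∧
      C = Cinner β ∘ Jstar ∘ Cinner α := by
  obtain ⟨ψ, hψ, hCψ⟩ := exists_eq_M_Jstar hC hCz
  have hCψ' : ∀ f : L2, ⇑(C f) =ᵐ[circleMeasure] fun t => ψ t * conj (f (-t)) := by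
    intro f
    filter_upwards [coeFn_M ψ (Jstar f), coeFn_sharp f] with t h1 h2
    rw [hCψ, h1, Jstar, h2]
  -- `C² = id` applied to the constant `1` says `ψ ψ^# = 1`.
  have hψψ : ∀ᵐ t ∂circleMeasure, ψ t * conj (ψ (-t)) = 1 := by
    have h := hCψ' (C one)
    rw [hC.invol] at h
    filter_upwards [h, ae_neg (hCψ' one), coeFn_one] with t h1 h2 h3
    rw [h2, h3] at h1
    rw [neg_neg, h3] at h1
    simpa using h1.symm
  set β : Linf := prod ψ (sharp α) with hβ
  have hβ' : ⇑β =ᵐ[circleMeasure] fun t => ψ t * conj (α (-t)) := by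
    filter_upwards [coeFn_prod ψ (sharp α), coeFn_sharp α] with t h1 h2
    rw [hβ, h1, h2]
  -- The inclusion, tested on `α = α · 1`, exhibits `β = C α` as an element of `θH²`.
  obtain ⟨h, hh, hCα⟩ := hsub ⟨M α one, ⟨one, one_mem_H2, rfl⟩, rfl⟩
  have hβh : ∀ᵐ t ∂circleMeasure, β t = θ t * h t := by
    filter_upwards [hβ', coeFn_M θ h, hCψ' (M α one), ae_neg (coeFn_M α one), ae_neg coeFn_one]
      with t h1 h2 h3 h4 h5
    rw [h1, ← h2, hCα, h3, h4, h5, mul_one]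
  set u : Linf := prod (star θ) β with hu
  have hu' : ⇑u =ᵐ[circleMeasure] fun t => conj (θ t) * β t := by
    filter_upwards [coeFn_prod (star θ) β, coeFn_conj θ] with t h1 h2
    rw [hu, h1, h2]
  have hui : IsInner u := by
    constructor
    · refine mem_Hinf_of_ae_eq hh ?_
      filter_upwards [hu', hβh, hθ.2] with t h1 h2 h3
      rw [h1, h2, ← mul_assoc, conj_mul_self_of_norm_one h3, one_mul]
    · filter_upwards [hu', hβ', hθ.2, hψ, ae_neg hα.2] with t h1 h2 h3 h4 h5
      rw [h1, h2]
      simp [h3, h4, h5]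
  have hβi : IsInner β := by
    have : β = prod θ u := by
      apply Lp.ext
      filter_upwards [coeFn_prod θ u, hu', hθ.2] with t h1 h2 h3
      rw [h1, h2]
      linear_combination -β t * conj_mul_self_of_norm_one h3
    rw [this]
    exact hθ.prod hui
  refine ⟨β, hβi, ⟨u, hui, ?_⟩, ?_, ?_⟩
  · filter_upwards [hu', hθ.2] with t h1 h2
    have h0 : θ t ≠ 0 := norm_ne_zero_iff.1 (by rw [h2]; exact one_ne_zero)
    rw [h1, eq_div_iff h0]
    linear_combination β t * conj_mul_self_of_norm_one h2
  · apply Lp.ext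
    filter_upwards [coeFn_prod β (sharp β), coeFn_sharp β, hβ', ae_neg hβ',
      coeFn_prod α (sharp α), coeFn_sharp α, hψψ] with t h1 h2 h3 h4 h5 h6 h7
    rw [h1, h2, h3, h4, h5, h6, neg_neg, map_mul, Complex.conj_conj]
    linear_combination conj (α (-t)) * α t * h7
  · funext f
    apply Lp.ext
    filter_upwards [coeFn_Cinner_Jstar_Cinner α β f, hCψ' f, hβ', ae_neg hα.2]
      with t h1 h2 h3 h4
    rw [h1, h2, h3]
    linear_combination -ψ t * conj (f (-t)) * conj_mul_self_of_norm_one h4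

end HardyConj

end

theorem theorem5p2 (α θ : HardyConj.Linf)
    (hα : HardyConj.IsInner α) (hθ : HardyConj.IsInner θ)
    (C : HardyConj.L2 → HardyConj.L2) (hC : HardyConj.IsConjugation C)
    (hCz : C ∘ HardyConj.M HardyConj.z = HardyConj.M HardyConj.z ∘ C) :
    (C '' HardyConj.shiftInv α ⊆ HardyConj.shiftInv θ ↔
      HardyConj.InnerLE (HardyConj.prod θ (HardyConj.sharp θ))
          (HardyConj.prod α (HardyConj.sharp α)) ∧
        ∃ β : HardyConj.Linf, HardyConj.IsInner β ∧ HardyConj.InnerLE θ β ∧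
          HardyConj.prod β (HardyConj.sharp β) = HardyConj.prod α (HardyConj.sharp α) ∧
          C = HardyConj.Cinner β ∘ HardyConj.Jstar ∘ HardyConj.Cinner α) ∧
    (∀ β : HardyConj.Linf, HardyConj.IsInner β → HardyConj.InnerLE θ β →
      HardyConj.prod β (HardyConj.sharp β) = HardyConj.prod α (HardyConj.sharp α) →
      C = HardyConj.Cinner β ∘ HardyConj.Jstar ∘ HardyConj.Cinner α →
      C '' HardyConj.shiftInv α = HardyConj.shiftInv β) := by
  refine ⟨⟨fun hsub => ?_, ?_⟩, ?_⟩
  · obtain ⟨β, hβ, hle, heq, hCβ⟩ := HardyConj.exists_inner_of_image_subset hα hθ hC hCz hsub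
    exact ⟨heq ▸ HardyConj.innerLE_prod_sharp hle, β, hβ, hle, heq, hCβ⟩
  · rintro ⟨-, β, -, hle, -, rfl⟩
    rw [HardyConj.image_shiftInv_eq hα]
    exact HardyConj.shiftInv_subset_of_innerLE hθ hle
  · rintro β - - - rfl
    exact HardyConj.image_shiftInv_eq hα
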